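/- All automata have finite state sets and a common finite alphabet $\Sigma$, are complete, and have transition-based acceptance: a transition is a tuple $(q,x,q',c)$ with a color $c\in\mathbb N$ that is determined by $(q,x,q')$, and a run on an infinite word is accepting if the lowest color that occurs infinitely often along it is even. A co-Büchi automaton uses only the colors $1$ (rejecting transitions) and $2$ (accepting transitions). An automaton $\mathcal A$ with state set $Q$ is good-for-games (GFG) if there is $f:\Sigma^*\to Q$ such that for every word $w=x_0x_1\ldots\in\Sigma^\omega$ the sequence $\pi_i=f(x_0\ldots x_{i-1})$ is a run, called the run induced by $f$ on $w$, which is accepting whenever $w\in L(\mathcal A)$. States $q,q'$ are equivalent if $L(\mathcal A,q)=L(\mathcal A,q')$, where $L(\mathcal A,q)$ is the language of $\mathcal A$ with initial state changed to $q$. A GFG co-Büchi automaton is *nice* if all its states are reachable and GFG; whenever $q'$ is reachable from $q$ by accepting transitions, $q$ is reachable from $q'$ by accepting transitions; for every state and letter there is at most one accepting transition; and any two successors of a state on the same letter are equivalent. A *canonical* GFG co-Büchi automaton is one obtained from a nice automaton $\mathcal B$, whose number of states is minimal among all GFG co-Büchi automata for $L(\mathcal B)$, by the following step of Abu Radi and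 Kupferman: keep all accepting transitions; and for every state $q$ and letter $x$, let the rejecting transitions from $q$ on $x$ lead, if $q$ has no accepting transition on $x$, to exactly those states that are equivalent in $\mathcal B$ to some $x$-successor of $q$ in $\mathcal B$, and otherwise let there be none. Let $\mathcal A^1,\ldots,\mathcal A^n$ be canonical GFG co-Büchi automata over $\Sigma$ with state sets $Q^1,\ldots,Q^n$ and $L(\mathcal A^1)\supsetneq\cdots\supsetneq L(\mathcal A^n)$ (for instance, a COCOA, i.e. the canonical chain of co-Büchi automata of an $\omega$-regular language). The natural color of a word is the largest $l$ such that $\mathcal A^l$ accepts it, or $0$ if there is none. Let $f^l:\Sigma^*\to Q^l$ ($1\le l\le n$) be strategies that induce runs on all words, such that for every word of natural color $c$ the runs induced by $f^1,\ldots,f^c$ are accepting. Let $f^l_\star:\Sigma^*\times Q^l\times\Sigma\rightharpoonup Q^l$ be the partial function defined, for $q$ reachable from the initial state of $\mathcal A^l$ on reading $p$, by $f^l_\star(p,q,x)=f^l(p\cdot x)$ if all transitions of $\mathcal A^l$ from $q$ on $x$ are rejecting, and otherwise by letting $f^l_\star(p,q,x)$ be the unique successor of $q$ on $x$. **Lemma.**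 Let $w=x_0x_1\ldots\in\Sigma^\omega$ and $l\in\{1,\ldots,n\}$. Suppose that $\mathcal A^l$ has a rejecting run $\rho=\rho_0\rho_1\ldots$ on $w$ that eventually adheres to $f^l_\star$, i.e. there is $m$ such that $\rho_{i+1}=f^l_\star(x_0\ldots x_{i-1},\rho_i,x_i)$ for all $i\ge m$. Then $\mathcal A^l$ rejects $w$, i.e. $w\notin L(\mathcal A^l)$. -/

import Mathlib

/-- A complete parity automaton with transition-based acceptance over the alphabet `α`
with state set `Q`. An element `(q, x, q', c)` of `δ` is a transition from `q` to `q'` on the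
letter `x` with color `c`. (Finiteness of `α` and `Q` is assumed where the structure is used; it
implies that `δ` is finite, by `color_unique`.) -/
structure ParityAutomaton (α Q : Type*) where
  init : Q
  δ : Set (Q × α × Q × ℕ)
  color_unique : ∀ q x q' c c', (q, x, q', c) ∈ δ → (q, x, q', c') ∈ δ → c = c'
  complete : ∀ q x, ∃ q' c, (q, x, q', c) ∈ δ

namespace ParityAutomaton

variable {α Q : Type*}

/-- The finite prefix `x₀ … x_{i-1}` of the infinite word `w = x₀ x₁ …`. -/
def wordPrefix (w : ℕ → α) (i : ℕ) : List α := (List.range i).map w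

/-- `π` is a run of `A` on the infinite word `w`. -/
def IsRun (A : ParityAutomaton α Q) (w : ℕ → α) (π : ℕ → Q) : Prop :=
  π 0 = A.init ∧ ∀ i, ∃ c, (π i, w i, π (i + 1), c) ∈ A.δ

/-- The color `c` occurs infinitely often in the color sequence induced by `w` and `π`. -/
def InfOften (A : ParityAutomaton α Q) (w : ℕ → α) (π : ℕ → Q) (c : ℕ) : Prop :=
  ∀ N, ∃ i, N ≤ i ∧ (π i, w i, π (i + 1), c) ∈ A.δ

/-- Min-even acceptance: the lowest color occurring infinitely often is even. -/
def IsAccepting (A : ParityAutomaton α Q) (w : ℕ → α) (π : ℕ → Q) : Prop :=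
  ∃ c, Even c ∧ A.InfOften w π c ∧ ∀ c' < c, ¬ A.InfOften w π c'

/-- The language of `A`: the words that have an accepting run. -/
def language (A : ParityAutomaton α Q) : Set (ℕ → α) :=
  {w | ∃ π, A.IsRun w π ∧ A.IsAccepting w π}

/-- `A` with its initial state changed to `q`. -/
def withInit (A : ParityAutomaton α Q) (q : Q) : ParityAutomaton α Q :=
  { A with init := q }

/-- Co-Büchi automata: only the colors `1` (rejecting) and `2` (accepting) occur. -/
def IsCoBuchi (A : ParityAutomaton α Q) : Prop :=
  ∀ q x q' c, (q, x, q', c) ∈ A.δ → c = 1 ∨ c = 2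

/-- The sequence of states that a strategy produces on `w`. -/
def induced (f : List α → Q) (w : ℕ → α) : ℕ → Q := fun i => f (wordPrefix w i)

/-- Good-for-games automata: some strategy produces a run on every word, which is accepting
whenever the word is in the language. -/
def IsGFG (A : ParityAutomaton α Q) : Prop :=
  ∃ f : List α → Q, ∀ w, A.IsRun w (induced f w) ∧
    (w ∈ A.language → A.IsAccepting w (induced f w))

/-- `A` can move from a state to another one by reading a finite word. -/
def Reaches (A : ParityAutomaton α Q) : Q → List α → Q → Prop
  | q, [], q' => q = q'
  | q, x :: p, q' => ∃ s c, (q, x, s, c) ∈ A.δ ∧ A.Reaches s p q'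

/-- There is an accepting transition from `q` to `q'`. -/
def SafeStep (A : ParityAutomaton α Q) (q q' : Q) : Prop := ∃ x, (q, x, q', 2) ∈ A.δ

/-- `q` and `q'` have the same suffix language. -/
def Equivalent (A : ParityAutomaton α Q) (q q' : Q) : Prop :=
  (A.withInit q).language = (A.withInit q').language

/-- Nice co-Büchi automata, in the sense of Abu Radi and Kupferman. -/
structure IsNice (A : ParityAutomaton α Q) : Prop where
  coBuchi : A.IsCoBuchi
  /-- every state is reachable -/
  reachable : ∀ q, ∃ p, A.Reaches A.init p q
  /-- every state is good-for-games -/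
  gfg : ∀ q, (A.withInit q).IsGFG
  /-- normal: accepting transitions do not connect different safe components, i.e. different
  strongly connected components of the graph of accepting transitions -/
  normal : ∀ q q', Relation.ReflTransGen A.SafeStep q q' →
    Relation.ReflTransGen A.SafeStep q' q
  /-- safe deterministic -/
  safeDet : ∀ q x s s', (q, x, s, 2) ∈ A.δ → (q, x, s', 2) ∈ A.δ → s = s'
  /-- semantically deterministic: successors on the same letter have the same language -/
  semDet : ∀ q x s c s' c', (q, x, s, c) ∈ A.δ → (q, x, s', c') ∈ A.δ → A.Equivalent s s'

/-- `A` has the least number of states among the good-for-games co-Büchi automata for its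
language. -/
def IsMinimal (A : ParityAutomaton α Q) : Prop :=
  ∀ (k : ℕ) (B : ParityAutomaton α (Fin k)), B.IsCoBuchi → B.IsGFG →
    B.language = A.language → Nat.card Q ≤ k

/-- The canonization step of Abu Radi and Kupferman (maximization up to homogeneity).
All accepting transitions are kept. From `q` on `x` there are rejecting transitions only if `q` has
no accepting transition on `x`, and then to all states with the same language as some
`x`-successor of `q`. -/
def canonize (B : ParityAutomaton α Q) : ParityAutomaton α Q where
  init := B.init
  δ := {t | match t with
    | (q, x, q', c) =>
      (c = 2 ∧ (q, x, q', 2) ∈ B.δ) ∨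
      (c = 1 ∧ (¬ ∃ s, (q, x, s, 2) ∈ B.δ) ∧
        ∃ s c', (q, x, s, c') ∈ B.δ ∧ B.Equivalent s q')}
  color_unique := by
    rintro q x q' c c' (⟨rfl, h⟩ | ⟨rfl, h, -⟩) (⟨rfl, h'⟩ | ⟨rfl, h', -⟩)
    · rfl
    · exact absurd ⟨_, h⟩ h'
    · exact absurd ⟨_, h'⟩ h
    · rfl
  complete := by
    intro q x
    by_cases h : ∃ s, (q, x, s, 2) ∈ B.δ
    · obtain ⟨s, hs⟩ := h
      exact ⟨s, 2, Or.inl ⟨rfl, hs⟩⟩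
    · obtain ⟨s, c, hs⟩ := B.complete q x
      exact ⟨s, 1, Or.inr ⟨rfl, h, s, c, hs, rfl⟩⟩

/-- Canonical good-for-games co-Büchi automata: the results of the canonization of nice
good-for-games co-Büchi automata with the minimal number of states. -/
def IsCanonical (A : ParityAutomaton α Q) : Prop :=
  ∃ B : ParityAutomaton α Q, B.IsNice ∧ B.IsMinimal ∧ A = B.canonize

/-- From `q` on `x` the automaton has to take a rejecting transition. -/
def NeedsRejecting (A : ParityAutomaton α Q) (q : Q) (x : α) : Prop :=
  ∀ q' c, (q, x, q', c) ∈ A.δ → c = 1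

/-- `q'` is a successor of `q` on `x`. -/
def IsSucc (A : ParityAutomaton α Q) (q : Q) (x : α) (q' : Q) : Prop :=
  ∃ c, (q, x, q', c) ∈ A.δ

open Classical in
/-- The get-back strategy of `f`, a partial function that is defined at `(p, q, x)` only if `q` is
reachable from the initial state on reading `p`. Its value is `f (p · x)` if a rejecting transition
has to be taken from `q` on `x`, and the unique successor of `q` on `x` otherwise. -/
noncomputable def getBack (A : ParityAutomaton α Q) (f : List α → Q)
    (p : List α) (q : Q) (x : α) : Option Q :=
  if A.Reaches A.init p q then
    if A.NeedsRejecting q x then some (f (p ++ [x]))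
    else if h : ∃! q', A.IsSucc q x q' then some h.choose
    else none
  else none

/-- From some moment on, every step of `ρ` on `w` is the one chosen by the get-back strategy
of `f`. -/
def EventuallyAdheres (A : ParityAutomaton α Q) (f : List α → Q) (w : ℕ → α) (ρ : ℕ → Q) :
    Prop :=
  ∃ m, ∀ i, m ≤ i → A.getBack f (wordPrefix w i) (ρ i) (w i) = some (ρ (i + 1))

end ParityAutomaton

/-- The automata `A 0, …, A (n - 1)` (the levels `1, …, n`) are canonical good-for-games co-Büchi
automata, and their languages form a strictly falling chain. (The canonical chain of an omega-regular
language is such a chain; conversely, every such chain represents the language of the words of even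
natural color.) -/
structure IsCanonicalChain {α : Type*} {n : ℕ} {Q : Fin n → Type*}
    (A : ∀ l, ParityAutomaton α (Q l)) : Prop where
  canonical : ∀ l, (A l).IsCanonical
  falling : ∀ k l, k < l → (A l).language ⊂ (A k).language

open Classical in
/-- The natural color of a word: the largest level whose automaton accepts it, or `0` if there is
none. The automaton `A l` has level `l + 1`. -/
noncomputable def naturalColor {α : Type*} {n : ℕ} {Q : Fin n → Type*}
    (A : ∀ l, ParityAutomaton α (Q l)) (w : ℕ → α) : ℕ :=
  (Finset.univ.filter fun l => w ∈ (A l).language).sup fun l => (l : ℕ) + 1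

/-- The strategies `f` produce runs on all words, and for every word of natural color `c` the
runs on the levels `1, …, c` are accepting. -/
structure AreGoldenStrategies {α : Type*} {n : ℕ} {Q : Fin n → Type*}
    (A : ∀ l, ParityAutomaton α (Q l)) (f : ∀ l, List α → Q l) : Prop where
  isRun : ∀ l w, (A l).IsRun w (ParityAutomaton.induced (f l) w)
  accepting : ∀ w, ∀ l : Fin n, (l : ℕ) + 1 ≤ naturalColor A w →
    (A l).IsAccepting w (ParityAutomaton.induced (f l) w)

namespace ParityAutomaton

variable {α Q : Type*}

/-! Argue by contradiction. If level `l` accepts `w`, then the natural color of `w` is at least that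
level (`le_naturalColor`), so the run induced by the strategy is accepting and eventually takes
accepting transitions only. A rejecting run takes a rejecting transition after that point and after
adherence has begun. By homogeneity (`IsCanonical.needsRejecting`) every transition was rejecting
there, so the get-back strategy moves to the state of the induced run. From a shared state, the
accepting transition of the induced run is the only move the get-back strategy allows. The two runs
thus stay merged, and no further rejecting transition occurs. -/

theorem wordPrefix_succ (w : ℕ → α) (i : ℕ) :
    wordPrefix w (i + 1) = wordPrefix w i ++ [w i] := by
  simp [wordPrefix, List.range_succ]

theorem IsCanonical.isCoBuchi {A : ParityAutomaton α Q} (hA : A.IsCanonical) : A.IsCoBuchi := by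
  obtain ⟨B, -, -, rfl⟩ := hA
  rintro q x q' c (⟨rfl, -⟩ | ⟨rfl, -⟩)
  · exact Or.inr rfl
  · exact Or.inl rfl

/-- Canonical automata are homogeneous: a state with a rejecting transition on a letter has only
rejecting transitions on it. -/
theorem IsCanonical.needsRejecting {A : ParityAutomaton α Q} (hA : A.IsCanonical)
    {q q' : Q} {x : α} (h : (q, x, q', 1) ∈ A.δ) : A.NeedsRejecting q x := by
  obtain ⟨B, -, -, rfl⟩ := hA
  rcases h with ⟨h, -⟩ | ⟨-, h, -⟩
  · exact absurd h (by decide)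
  rintro s c (⟨rfl, hs⟩ | ⟨rfl, -⟩)
  · exact absurd ⟨s, hs⟩ h
  · rfl

/-- A run of a co-Büchi automaton is accepting iff it takes finitely many rejecting transitions. -/
theorem IsCoBuchi.isAccepting_iff {A : ParityAutomaton α Q} (hA : A.IsCoBuchi) {w : ℕ → α}
    {π : ℕ → Q} (hπ : A.IsRun w π) : A.IsAccepting w π ↔ ¬ A.InfOften w π 1 := by
  constructor
  · rintro ⟨c, hc, hinf, hlow⟩
    obtain ⟨i, -, hi⟩ := hinf 0
    rcases hA _ _ _ _ hi with rfl | rfl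
    · exact absurd hc (by decide)
    · exact hlow 1 (by decide)
  · intro h
    refine ⟨2, even_two, fun N => ?_, fun c hc hinf => ?_⟩
    · simp only [InfOften, not_forall, not_exists, not_and] at h
      obtain ⟨M, hM⟩ := h
      obtain ⟨c, hc⟩ := hπ.2 (max M N)
      rcases hA _ _ _ _ hc with rfl | rfl
      · exact absurd hc (hM _ (le_max_left _ _))
      · exact ⟨_, le_max_right _ _, hc⟩
    · obtain ⟨i, -, hi⟩ := hinf 0
      rcases hA _ _ _ _ hi with rfl | rfl
      · exact h hinf
      · exact lt_irrefl _ hc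

theorem eq_of_getBack_of_needsRejecting {A : ParityAutomaton α Q} {f : List α → Q} {p : List α}
    {q q' : Q} {x : α} (h : A.getBack f p q x = some q') (hx : A.NeedsRejecting q x) :
    q' = f (p ++ [x]) := by
  unfold getBack at h
  split_ifs at h
  exact (Option.some.inj h).symm

/-- Uniqueness of the successor comes from definedness: outside the rejecting case, `getBack` has a
value only if there is exactly one successor. -/
theorem eq_of_getBack_of_isSucc {A : ParityAutomaton α Q} {f : List α → Q} {p : List α}
    {q q' s : Q} {x : α} (h : A.getBack f p q x = some q') (hx : ¬ A.NeedsRejecting q x)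
    (hs : A.IsSucc q x s) : q' = s := by
  unfold getBack at h
  split_ifs at h with h₁ h₂
  rw [← Option.some.inj h]
  exact (h₂.choose_spec.2 s hs).symm

/-- If the run induced by `f` on `w` is accepting, then so is every run on `w` that eventually
adheres to the get-back strategy of `f`: a rejecting transition makes it join the induced run, with
which it agrees as long as the latter takes accepting transitions. -/
theorem IsCanonical.isAccepting_of_eventuallyAdheres {A : ParityAutomaton α Q}
    (hA : A.IsCanonical) {f : List α → Q} {w : ℕ → α} {ρ : ℕ → Q}
    (hf : A.IsRun w (induced f w)) (hacc : A.IsAccepting w (induced f w))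
    (hρ : A.IsRun w ρ) (hadh : A.EventuallyAdheres f w ρ) : A.IsAccepting w ρ := by
  have hCB := hA.isCoBuchi
  rw [hCB.isAccepting_iff hρ]
  intro hinf
  have hfin := (hCB.isAccepting_iff hf).1 hacc
  simp only [InfOften, not_forall, not_exists, not_and] at hfin
  obtain ⟨N, hN⟩ := hfin
  have hsafe : ∀ i, N ≤ i → (induced f w i, w i, induced f w (i + 1), 2) ∈ A.δ := by
    intro i hi
    obtain ⟨c, hc⟩ := hf.2 i
    rcases hCB _ _ _ _ hc with rfl | rfl
    · exact absurd hc (hN i hi)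
    · exact hc
  obtain ⟨m, hm⟩ := hadh
  -- Past `m` the run `ρ` adheres, and past `N` the induced run is free of rejecting transitions.
  obtain ⟨i, hi, hrej⟩ := hinf (max m N)
  have hmi : m ≤ i := (le_max_left _ _).trans hi
  have hNi : N ≤ i := (le_max_right _ _).trans hi
  -- The runs meet at `i + 1`, the target of the rejecting transition; they may still differ at `i`.
  have hagree : ∀ j, i + 1 ≤ j → ρ j = induced f w j := by
    intro j hj
    induction j, hj using Nat.le_induction with
    | base =>
      rw [eq_of_getBack_of_needsRejecting (hm i hmi) (hA.needsRejecting hrej), induced,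
        wordPrefix_succ]
    | succ j hj ih =>
      have hstep := hsafe j (by omega)
      rw [← ih] at hstep
      exact eq_of_getBack_of_isSucc (hm j (by omega))
        (fun h => absurd (h _ _ hstep) (by decide)) ⟨2, hstep⟩
  -- A second rejecting transition, taken after the merge, would belong to the induced run as well.
  obtain ⟨j, hj, hrej'⟩ := hinf (i + 1)
  rw [hagree j hj, hagree (j + 1) (by omega)] at hrej'
  exact hN j (by omega) hrej'

end ParityAutomaton

/-- Makes `AreGoldenStrategies.accepting` applicable at every level that accepts `w`, not only at
the largest one. -/
theorem le_naturalColor {α : Type*} {n : ℕ} {Q : Fin n → Type*}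
    (A : ∀ l, ParityAutomaton α (Q l)) {w : ℕ → α} {l : Fin n} (h : w ∈ (A l).language) :
    (l : ℕ) + 1 ≤ naturalColor A w := by
  classical
  unfold naturalColor
  exact Finset.le_sup (f := fun l : Fin n => (l : ℕ) + 1) (by simpa using h)

theorem mainTheorem4 {α : Type*} [Finite α] {n : ℕ} {Q : Fin n → Type*} [∀ l, Finite (Q l)]
    (A : ∀ l, ParityAutomaton α (Q l)) (hA : IsCanonicalChain A)
    (f : ∀ l, List α → Q l) (hf : AreGoldenStrategies A f)
    (w : ℕ → α) (l : Fin n) (ρ : ℕ → Q l)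
    (hrun : (A l).IsRun w ρ) (hrej : ¬ (A l).IsAccepting w ρ)
    (hadh : (A l).EventuallyAdheres (f l) w ρ) :
    w ∉ (A l).language := fun hw =>
  hrej ((hA.canonical l).isAccepting_of_eventuallyAdheres (hf.isRun l w)
    (hf.accepting w l (le_naturalColor A hw)) hrun hadh)
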